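/- Definitions. Let $S$ be a finite linearly ordered set; a hypergraph on $S$ is a family of subsets of $S$ (its hyperedges), and $\bar X$ denotes the complement of $X$. A hypergraph $\mathcal F$ is ABA-free if there are no $X,Y\in\mathcal F$ and $x<y<z$ with $x,z\in X\setminus Y$ and $y\in Y\setminus X$. A hypergraph $\mathcal H$ is a pseudohalfplane hypergraph if there is an ABA-free $\mathcal F$ on the same ordered vertex set (a witness of $\mathcal H$) with $\mathcal H\subseteq\mathcal F\cup\bar{\mathcal F}$, where $\bar{\mathcal F}=\{\bar X: X\in\mathcal F\}$; the members of $\mathcal H\cap\mathcal F$ are its topsets and those of $\mathcal H\cap\bar{\mathcal F}$ its bottomsets. The convex hull of a set $X$ of vertices is $Conv(X)=\bigcap\{Y\in\mathcal H: X\subseteq Y\}$ (the whole vertex set if there is no such $Y$). A set $X$ separates disjoint sets $A$ and $B$ if $A\subseteq X$ and $X\cap B=\emptyset$, or $X\cap A=\emptyset$ and $B\subseteq X$. Let $\mathcal H'$ be a pseudohalfplane hypergraph with witness $\mathcal F'$. An extension of $\mathcal H'$ by a new vertex $v$ is a pseudohalfplane hypergraph $\mathcal H^+$, with a witness $\mathcal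 F^+$, on $S\cup\{v\}$ (with any linear order extending that of $S$), together with bijections $t$ and $b$ from the topsets and the bottomsets of $\mathcal H'$ onto the topsets and the bottomsets of $\mathcal H^+$, respectively, such that $t(X)\cap S=X$ for every topset $X$, $b(X)\cap S=X$ for every bottomset $X$, and $b(\bar X)$ is the complement of $t(X)$ in $S\cup\{v\}$ whenever $X$ is a topset and $\bar X$ a bottomset of $\mathcal H'$. Theorem. Let $\mathcal H$ be a pseudohalfplane hypergraph on a finite linearly ordered vertex set $S$ and let $A,B\subseteq S$ be disjoint. The following are equivalent: (1) There is a pseudohalfplane hypergraph $\mathcal H'\supseteq\mathcal H$ on $S$, with a witness $\mathcal F'$, that has no extension by a new vertex $v$ in which $v\in Conv(A)\cap Conv(B)$. (2) There is a pseudohalfplane hypergraph $\mathcal H'\supseteq\mathcal H$ on $S$, with a witness $\mathcal F'$, such that for no $D\subseteq S$ with $|D|\le 4$ there is an extension of $\mathcal H'$ by a new vertex $v$ in which $v\in Conv(A\cap D)\cap Conv(B\cap D)$. (3) There is a set $X\subseteq S$ separating $A$ and $B$ such that $\mathcal H\cup\{X\}$ is a pseudohalfplane hypergraph. Moreover, if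 $\mathcal H$ is given together with a fixed witness $\mathcal F$, then (1), (2) and (3) are also equivalent when the larger hypergraphs $\mathcal H'$ in (1) and (2) and $\mathcal H\cup\{X\}$ in (3) are each required to have a witness ($\mathcal F'$ in (1) and (2)) for which all topsets of $\mathcal H$ are still topsets and all bottomsets of $\mathcal H$ are still bottomsets. -/

import Mathlib

/-- A hypergraph `F` on a vertex set ordered by `lt` is ABA-free: it has no two hyperedges `X`, `Y`
and vertices `x < y < z` with `x, z ∈ X \ Y` and `y ∈ Y \ X`. -/
def ABAFree {α : Type*} (lt : α → α → Prop) (F : Set (Set α)) : Prop :=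
  ∀ X ∈ F, ∀ Y ∈ F, ¬ ∃ x y z, lt x y ∧ lt y z ∧ x ∈ X \ Y ∧ z ∈ X \ Y ∧ y ∈ Y \ X

/-- The ABA-free hypergraph `F` witnesses that `H` is a pseudohalfplane hypergraph: every hyperedge
of `H` is a member of `F` or the complement of a member of `F`. -/
structure IsWitness {α : Type*} (lt : α → α → Prop) (H F : Set (Set α)) : Prop where
  abaFree : ABAFree lt F
  subset : H ⊆ F ∪ {X | Xᶜ ∈ F}

/-- `H` is a pseudohalfplane hypergraph with respect to the vertex order `lt`. -/
def IsPseudohalfplane {α : Type*} (lt : α → α → Prop) (H : Set (Set α)) : Prop :=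
  ∃ F, IsWitness lt H F

/-- The topsets of `H` with respect to the ABA-free hypergraph `F`. -/
def topsets {α : Type*} (H F : Set (Set α)) : Set (Set α) := {X ∈ H | X ∈ F}

/-- The bottomsets of `H` with respect to the ABA-free hypergraph `F`. -/
def bottomsets {α : Type*} (H F : Set (Set α)) : Set (Set α) := {X ∈ H | Xᶜ ∈ F}

/-- The convex hull of a vertex set: the intersection of all hyperedges containing it
(all vertices, if there is no such hyperedge). -/
def hullOf {α : Type*} (H : Set (Set α)) (X : Set α) : Set α := ⋂₀ {Y ∈ H | X ⊆ Y}

/-- `X` separates `A` and `B`. -/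
def Separates {α : Type*} (X A B : Set α) : Prop :=
  (A ⊆ X ∧ X ∩ B = ∅) ∨ (X ∩ A = ∅ ∧ B ⊆ X)

/-- The pseudohalfplane hypergraph `H⁺` (with ABA-free hypergraph `F⁺`) is an extension of `H`
(with ABA-free hypergraph `F`) by one new vertex. The enlarged vertex set is `Option S`, the new
vertex being `none`; its order `lt` extends the order of `S`, so `none` may be put in any position.
The maps `t` and `b` are the bijections between the topsets and between the bottomsets. -/
def IsVertexExtension {S : Type*} [LinearOrder S] (H F : Set (Set S))
    (lt : Option S → Option S → Prop) (Hp Fp : Set (Set (Option S))) : Prop :=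
  IsStrictTotalOrder (Option S) lt ∧
  (∀ x y : S, lt (some x) (some y) ↔ x < y) ∧
  IsWitness lt Hp Fp ∧
  ∃ t b : Set S → Set (Option S),
    Set.BijOn t (topsets H F) (topsets Hp Fp) ∧
    Set.BijOn b (bottomsets H F) (bottomsets Hp Fp) ∧
    (∀ X ∈ topsets H F, some ⁻¹' t X = X) ∧
    (∀ X ∈ bottomsets H F, some ⁻¹' b X = X) ∧
    (∀ X ∈ topsets H F, Xᶜ ∈ bottomsets H F → b Xᶜ = (t X)ᶜ)

/-- `H` (with ABA-free hypergraph `F`) can be extended by a new vertex `v` such that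
`v ∈ Conv(A) ∩ Conv(B)` in the extended hypergraph. -/
def HasVertexInHulls {S : Type*} [LinearOrder S] (H F : Set (Set S)) (A B : Set S) : Prop :=
  ∃ lt Hp Fp, IsVertexExtension H F lt Hp Fp ∧
    none ∈ hullOf Hp (some '' A) ∩ hullOf Hp (some '' B)

/-!
A separating set `X` may be added to the hypergraph together with its complement. In an extension the
images of `X` and `Xᶜ` remain complementary, and they contain the hulls of `A` and `B`, which are
therefore disjoint; the same holds for the traces of `A` and `B` on any `D`.

Conversely, let `F` be a witness and enlarge it to a maximal ABA-free family `G`. If a member of `G`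
separates `A` and `B`, then `G` is the required witness. Otherwise a set `D` of at most four vertices
and a new vertex in the hulls of `A ∩ D` and `B ∩ D` are constructed. The members of `G` behave like
pseudolines, partially ordered by slope (`SlopeLT.trans`), and maximality is used through cuts of this
order. A cut determines a partial order on the vertices (`CutRel.trans`), and every set that is upward
closed in it is compatible with `G` (`ABAFree.insert_of_closed`), hence belongs to `G`. This gives the
pseudoline through two given vertices (`IsMaximalABAFree.exists_line`), and it turns the absence of
separators into inequalities between the times at which pairs of vertices are swapped when the slope
increases (`IsMaximalABAFree.exists_swapTime_lt`). Kirchberger's theorem, that already at most four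
vertices cannot be separated, becomes a statement about these swap times
(`exists_overlap_ncard_le_four`).

If one of the two traces is a single vertex, the new vertex is a twin of it
(`hasCommonPoint_singleton`). Otherwise both are pairs, and the new vertex is the crossing point of the
two segments (`hasCommonPoint_of_lines`). For a fixed position of the new vertex the only restriction
is that the members of `G` containing it be closed upwards in the vertical order of the curves
there (`ABAFree.extendSet`). That order is transitive (`BelowAt.trans`), since rotating the vertex
order cyclically makes it a slope order. At the position where the lines through the two pairs cross,
neither line is strictly below the other, and this keeps the required memberships consistent.
-/

/-! ### The slope order -/

/-- `SlopeLT lt X Y`: some `i` in `Y \ X` precedes some `j` in `X \ Y`. Thinking of the members of an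
ABA-free family as the sets of points above `x`-monotone curves, the curves of `X` and `Y` cross and
the curve of `Y` starts below the curve of `X`. -/
def SlopeLT {α : Type*} (lt : α → α → Prop) (X Y : Set α) : Prop :=
  ∃ i j, lt i j ∧ i ∈ Y \ X ∧ j ∈ X \ Y

/-- On an ABA-free family `SlopeLT` is transitive, hence a strict partial order. -/
theorem SlopeLT.trans {α : Type*} {lt : α → α → Prop} [IsStrictTotalOrder α lt] {F : Set (Set α)}
    (hF : ABAFree lt F) {X Y Z : Set α} (hX : X ∈ F) (hY : Y ∈ F) (hZ : Z ∈ F)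
    (h₁ : SlopeLT lt X Y) (h₂ : SlopeLT lt Y Z) : SlopeLT lt X Z := by
  obtain ⟨i, j, hij, ⟨hiY, hiX⟩, hjX, hjY⟩ := h₁
  obtain ⟨k, l, hkl, ⟨hkZ, hkY⟩, hlY, hlZ⟩ := h₂
  have hXY := hF X hX Y hY
  have hYX := hF Y hY X hX
  have hYZ := hF Y hY Z hZ
  have hZY := hF Z hZ Y hY
  have start : ∃ m, (m = i ∨ lt m i) ∧ m ∈ Z \ X := by
    by_cases hiZ : i ∈ Z
    · exact ⟨i, .inl rfl, hiZ, hiX⟩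
    · have hki : lt k i := by
        rcases trichotomous_of lt k i with h | rfl | h
        · exact h
        · exact absurd hiY hkY
        · exact absurd ⟨i, k, l, h, hkl, ⟨hiY, hiZ⟩, ⟨hlY, hlZ⟩, hkZ, hkY⟩ hYZ
      refine ⟨k, .inr hki, hkZ, fun hkX => hXY ⟨k, i, j, hki, hij, ⟨hkX, hkY⟩, ⟨hjX, hjY⟩, hiY, hiX⟩⟩
  have finish : ∃ m, (m = j ∨ lt j m) ∧ m ∈ X \ Z := by
    by_cases hjZ : j ∈ Z
    · have hjl : lt j l := by
        rcases trichotomous_of lt j l with h | rfl | h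
        · exact h
        · exact absurd hlY hjY
        · exact absurd ⟨k, l, j, hkl, h, ⟨hkZ, hkY⟩, ⟨hjZ, hjY⟩, hlY, hlZ⟩ hZY
      refine ⟨l, .inr hjl, ?_, hlZ⟩
      by_contra hlX
      exact hYX ⟨i, j, l, hij, hjl, ⟨hiY, hiX⟩, ⟨hlY, hlX⟩, hjX, hjY⟩
    · exact ⟨j, .inl rfl, hjX, hjZ⟩
  obtain ⟨m, hm, hmZ⟩ := start
  obtain ⟨n, hn, hnX⟩ := finish
  refine ⟨m, n, ?_, hmZ, hnX⟩
  have hmj : lt m j := by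
    rcases hm with rfl | hm
    · exact hij
    · exact _root_.trans hm hij
  rcases hn with rfl | hn
  · exact hmj
  · exact _root_.trans hmj hn

theorem SlopeLT.asymm {α : Type*} {lt : α → α → Prop} [IsStrictTotalOrder α lt] {F : Set (Set α)}
    (hF : ABAFree lt F) {X Y : Set α} (hX : X ∈ F) (hY : Y ∈ F)
    (h₁ : SlopeLT lt X Y) (h₂ : SlopeLT lt Y X) : False := by
  obtain ⟨i, -, -, hi, -⟩ := SlopeLT.trans hF hX hY hX h₁ h₂
  exact hi.2 hi.1

/-! ### Cuts of an ABA-free family and maximal families -/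

section Cuts

variable {S : Type*} [LinearOrder S] {G C : Set (Set S)}

/-- `CutRel G C x y` says that a new member of `G` placed, in the slope order, after the members of
`C` and before those of `G \ C` has to contain `y` if it contains `x`. -/
def CutRel (G C : Set (Set S)) (x y : S) : Prop :=
  (x < y ∧ ∃ X ∈ G, X ∉ C ∧ x ∉ X ∧ y ∈ X) ∨ (y < x ∧ ∃ X ∈ G, X ∈ C ∧ y ∈ X ∧ x ∉ X)

/-- `C` restricted to `G` is a lower set for the slope order. `C` need not be a subset of `G`. -/
def IsCut (G C : Set (Set S)) : Prop :=
  ∀ X ∈ G, ∀ Y ∈ G, SlopeLT (· < ·) X Y → Y ∈ C → X ∈ C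

theorem CutRel.trans (hG : ABAFree (· < ·) G) (hC : IsCut G C) {x y z : S}
    (hxy : CutRel G C x y) (hyz : CutRel G C y z) : CutRel G C x z := by
  rcases hxy with ⟨hxy, X, hX, hXC, hxX, hyX⟩ | ⟨hxy, X, hX, hXC, hyX, hxX⟩ <;>
  rcases hyz with ⟨hyz, Y, hY, hYC, hyY, hzY⟩ | ⟨hyz, Y, hY, hYC, hzY, hyY⟩
  · refine .inl ⟨hxy.trans hyz, ?_⟩
    by_cases hzX : z ∈ X
    · exact ⟨X, hX, hXC, hxX, hzX⟩
    · refine ⟨Y, hY, hYC, fun hxY => ?_, hzY⟩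
      exact hG Y hY X hX ⟨x, y, z, hxy, hyz, ⟨hxY, hxX⟩, ⟨hzY, hzX⟩, hyX, hyY⟩
  · have hzX : z ∈ X := by
      by_contra hzX
      exact hXC (hC X hX Y hY ⟨z, y, hyz, ⟨hzY, hzX⟩, hyX, hyY⟩ hYC)
    rcases lt_trichotomy x z with h | rfl | h
    · exact .inl ⟨h, X, hX, hXC, hxX, hzX⟩
    · exact absurd hzX hxX
    · refine .inr ⟨h, Y, hY, hYC, hzY, fun hxY => ?_⟩
      exact hXC (hC X hX Y hY ⟨x, y, hxy, ⟨hxY, hxX⟩, hyX, hyY⟩ hYC)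
  · have hxY : x ∉ Y := fun hxY =>
      hYC (hC Y hY X hX ⟨y, x, hxy, ⟨hyX, hyY⟩, hxY, hxX⟩ hXC)
    rcases lt_trichotomy x z with h | rfl | h
    · exact .inl ⟨h, Y, hY, hYC, hxY, hzY⟩
    · exact absurd hzY hxY
    · refine .inr ⟨h, X, hX, hXC, ?_, hxX⟩
      by_contra hzX
      exact hYC (hC Y hY X hX ⟨y, z, hyz, ⟨hyX, hyY⟩, hzY, hzX⟩ hXC)
  · refine .inr ⟨hyz.trans hxy, ?_⟩
    by_cases hzX : z ∈ X
    · exact ⟨X, hX, hXC, hzX, hxX⟩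
    · refine ⟨Y, hY, hYC, hzY, fun hxY => ?_⟩
      exact hG Y hY X hX ⟨z, y, x, hyz, hxy, ⟨hzY, hzX⟩, ⟨hxY, hxX⟩, hyX, hyY⟩

/-- No hypothesis on `C` is needed: closure under `CutRel G C` already excludes both kinds of
alternation between `L` and each single member of `G`. -/
theorem ABAFree.insert_of_closed (hG : ABAFree (· < ·) G) {L : Set S}
    (hL : ∀ x ∈ L, ∀ y, CutRel G C x y → y ∈ L) : ABAFree (· < ·) (insert L G) := by
  rintro X hX Y hY ⟨x, y, z, hxy, hyz, ⟨hxX, hxY⟩, ⟨hzX, hzY⟩, hyY, hyX⟩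
  rcases hX with rfl | hX <;> rcases hY with rfl | hY
  · exact hxY hxX
  · by_cases hC : Y ∈ C
    · exact hyX (hL z hzX y (.inr ⟨hyz, Y, hY, hC, hyY, hzY⟩))
    · exact hyX (hL x hxX y (.inl ⟨hxy, Y, hY, hC, hxY, hyY⟩))
  · by_cases hC : X ∈ C
    · exact hxY (hL y hyY x (.inr ⟨hxy, X, hX, hC, hxX, hyX⟩))
    · exact hzY (hL y hyY z (.inl ⟨hyz, X, hX, hC, hyX, hzX⟩))
  · exact hG X hX Y hY ⟨x, y, z, hxy, hyz, ⟨hxX, hxY⟩, ⟨hzX, hzY⟩, hyY, hyX⟩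

/-- `G` is inclusion-maximal among the ABA-free families. -/
structure IsMaximalABAFree (G : Set (Set S)) : Prop where
  abaFree : ABAFree (· < ·) G
  mem_of_insert : ∀ L, ABAFree (· < ·) (insert L G) → L ∈ G

theorem exists_isMaximalABAFree [Finite S] {F : Set (Set S)} (hF : ABAFree (· < ·) F) :
    ∃ G, F ⊆ G ∧ IsMaximalABAFree G := by
  obtain ⟨G, hFG, hG⟩ := (Set.toFinite {G : Set (Set S) | ABAFree (· < ·) G}).exists_le_maximal hF
  exact ⟨G, hFG, hG.prop, fun L hL => hG.le_of_ge hL (Set.subset_insert L G) (Set.mem_insert L G)⟩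

/-- If no member of `G` contains `A` and misses `B`, then at every cut the upward closure of `A` meets
`B`, as that closure is a member of `G`. -/
theorem IsMaximalABAFree.exists_cutRel (hG : IsMaximalABAFree G) (hC : IsCut G C) {A B : Set S}
    (hAB : Disjoint A B) (hsep : ∀ X ∈ G, A ⊆ X → (X ∩ B).Nonempty) :
    ∃ a ∈ A, ∃ b ∈ B, CutRel G C a b := by
  have hL : {x | ∃ a ∈ A, x = a ∨ CutRel G C a x} ∈ G := by
    refine hG.mem_of_insert _ (hG.abaFree.insert_of_closed (C := C) ?_)
    rintro x ⟨a, ha, rfl | hax⟩ y hxy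
    · exact ⟨x, ha, .inr hxy⟩
    · exact ⟨a, ha, .inr (hax.trans hG.abaFree hC hxy)⟩
  obtain ⟨b, ⟨a, ha, rfl | hab⟩, hb⟩ := hsep _ hL fun a ha => ⟨a, ha, .inl rfl⟩
  · exact absurd hb (Set.disjoint_left.mp hAB ha)
  · exact ⟨a, ha, b, hb, hab⟩

/-- A maximal family contains the curve through any two vertices: a set `W` to which the two vertices
can be added independently. The two vertices are unrelated at a suitable cut, and `W` consists of
everything that is above one of them there. -/
theorem IsMaximalABAFree.exists_line (hG : IsMaximalABAFree G) {a b : S} (hab : a ≠ b) :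
    ∃ W : Set S, a ∉ W ∧ b ∉ W ∧ W ∈ G ∧ insert a W ∈ G ∧ insert b W ∈ G ∧
      insert a (insert b W) ∈ G := by
  wlog h : a < b generalizing a b
  · obtain ⟨W, h₁, h₂, h₃, h₄, h₅, h₆⟩ := this hab.symm (lt_of_le_of_ne (not_lt.mp h) hab.symm)
    exact ⟨W, h₂, h₁, h₃, h₅, h₄, by rwa [Set.insert_comm]⟩
  have hF := hG.abaFree
  -- The cut right after the last member that contains `b` but not `a`.
  let C : Set (Set S) := {X | ∃ Y ∈ G, a ∉ Y ∧ b ∈ Y ∧ (X = Y ∨ SlopeLT (· < ·) X Y)}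
  have hC : IsCut G C := by
    rintro X hX Y hY hXY ⟨Z, hZ, haZ, hbZ, rfl | hYZ⟩
    · exact ⟨Y, hZ, haZ, hbZ, .inr hXY⟩
    · exact ⟨Z, hZ, haZ, hbZ, .inr (hXY.trans hF hX hY hZ hYZ)⟩
  have hab' : ¬ CutRel G C a b := by
    rintro (⟨-, X, hX, hXC, haX, hbX⟩ | ⟨hba, -⟩)
    · exact hXC ⟨X, hX, haX, hbX, .inl rfl⟩
    · exact hba.not_gt h
  have hba' : ¬ CutRel G C b a := by
    rintro (⟨hba, -⟩ | ⟨-, X, hX, ⟨Y, hY, haY, hbY, hXY⟩, haX, hbX⟩)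
    · exact hba.not_gt h
    · rcases hXY with rfl | hXY
      · exact haY haX
      · exact SlopeLT.asymm hF hX hY hXY ⟨a, b, h, ⟨haX, haY⟩, hbY, hbX⟩
  have hirr : ∀ x, ¬ CutRel G C x x := by
    rintro x (⟨hx, -⟩ | ⟨hx, -⟩) <;> exact lt_irrefl x hx
  refine ⟨{x | CutRel G C a x ∨ CutRel G C b x}, ?_, ?_, ?_, ?_, ?_, ?_⟩
  · exact fun h => h.elim (hirr a) hba'
  · exact fun h => h.elim hab' (hirr b)
  all_goals
    refine hG.mem_of_insert _ (hF.insert_of_closed (C := C) fun x hx y hxy => ?_)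
    have step : ∀ z, CutRel G C z x → CutRel G C z y := fun z hz => hz.trans hF hC hxy
    simp only [Set.mem_insert_iff, Set.mem_ofPred_eq] at hx ⊢
    grind

end Cuts

/-! ### Reduction to four vertices -/

section Kirchberger

variable {S : Type*} [LinearOrder S]

/-- Think of the vertices as being gradually permuted from increasing to decreasing order, `T x y` being
the time at which `x < y` are swapped. `Overlap T A B` exhibits a pair of `A × B` in increasing order
that is swapped no earlier than some pair of `A × B` in decreasing order; so at no time do all
vertices of `B` precede all vertices of `A`. -/
def Overlap (T : S → S → ℕ) (A B : Set S) : Prop :=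
  ∃ a ∈ A, ∃ b ∈ B, ∃ a' ∈ A, ∃ b' ∈ B, a < b ∧ b' < a' ∧ T b' a' ≤ T a b

/-- The swap time of `x < z` lies between those of `x < y` and `y < z`. -/
structure IsBetween (T : S → S → ℕ) : Prop where
  le_max : ∀ x y z, x < y → y < z → T x z ≤ max (T x y) (T y z)
  min_le : ∀ x y z, x < y → y < z → min (T x y) (T y z) ≤ T x z

theorem ncard_four_le (w x y z : S) : ({w, x, y, z} : Set S).ncard ≤ 4 := by
  classical
  simpa [← Set.ncard_coe_finset] using Finset.card_le_four (a := w) (b := x) (c := y) (d := z)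

/-- The reduction to four vertices, when the pair `a₁ < b` swapped before the last decreasing pair
`b < a` shares the vertex `b` with it. -/
theorem exists_overlap_of_shared {T : S → S → ℕ} {A B : Set S} {a b a₁ a₂ b₂ : S}
    (ha : a ∈ A) (hb : b ∈ B) (ha₁ : a₁ ∈ A) (ha₂ : a₂ ∈ A) (hb₂ : b₂ ∈ B) (hb2 : a₂ ≠ b)
    (hab : a ≠ b₂)
    (hba : b < a) (hmax : ∀ a' ∈ A, ∀ b' ∈ B, b' < a' → T b' a' ≤ T b a)
    (h₁ : a₁ < b) (hT₁ : T a₁ b < T b a) (h₂ : a₂ < b₂) (hT₂ : T b a ≤ T a₂ b₂) :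
    ∃ D : Set S, D.ncard ≤ 4 ∧ Overlap T (A ∩ D) (B ∩ D) ∧ Overlap T (B ∩ D) (A ∩ D) := by
  rcases hb2.lt_or_gt with h | h
  · by_cases hT : T a₂ b < T b a
    · exact ⟨{a, b, a₂, b₂}, ncard_four_le _ _ _ _,
        ⟨a₂, by simp [*], b₂, by simp [*], a, by simp [*], b, by simp [*], h₂, hba, hT₂⟩,
        ⟨b, by simp [*], a, by simp [*], b, by simp [*], a₂, by simp [*], hba, h, hT.le⟩⟩
    · exact ⟨{a, b, a₁, a₂}, ncard_four_le _ _ _ _,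
        ⟨a₂, by simp [*], b, by simp [*], a, by simp [*], b, by simp [*], h, hba, not_lt.mp hT⟩,
        ⟨b, by simp [*], a, by simp [*], b, by simp [*], a₁, by simp [*], hba, h₁, hT₁.le⟩⟩
  · rcases hab.lt_or_gt with h' | h'
    · by_cases hT : T a b₂ < T b a
      · exact ⟨{a, b, a₂, b₂}, ncard_four_le _ _ _ _,
          ⟨a₂, by simp [*], b₂, by simp [*], a, by simp [*], b, by simp [*], h₂, hba, hT₂⟩,
          ⟨b, by simp [*], a, by simp [*], b₂, by simp [*], a, by simp [*], hba, h', hT.le⟩⟩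
      · exact ⟨{a, b, a₁, b₂}, ncard_four_le _ _ _ _,
          ⟨a, by simp [*], b₂, by simp [*], a, by simp [*], b, by simp [*], h', hba, not_lt.mp hT⟩,
          ⟨b, by simp [*], a, by simp [*], b, by simp [*], a₁, by simp [*], hba, h₁, hT₁.le⟩⟩
    · by_cases hT : T a₁ b ≤ T b a₂
      · exact ⟨{a₁, a₂, b, b₂}, ncard_four_le _ _ _ _,
          ⟨a₂, by simp [*], b₂, by simp [*], a₂, by simp [*], b, by simp [*], h₂, h,
            (hmax a₂ ha₂ b hb h).trans hT₂⟩,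
          ⟨b, by simp [*], a₂, by simp [*], b, by simp [*], a₁, by simp [*], h, h₁, hT⟩⟩
      · exact ⟨{a, a₁, a₂, b}, ncard_four_le _ _ _ _,
          ⟨a₁, by simp [*], b, by simp [*], a₂, by simp [*], b, by simp [*], h₁, h,
            (not_le.mp hT).le⟩,
          ⟨b, by simp [*], a, by simp [*], b, by simp [*], a₁, by simp [*], hba, h₁, hT₁.le⟩⟩

/-- If some increasing pair of `A × B` is swapped before the last decreasing one, then there is such an
increasing pair that shares a vertex with a last decreasing pair. The last decreasing pair may have
to be replaced by another one with the same swap time. -/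
theorem exists_shared_endpoint {T : S → S → ℕ} (hT : IsBetween T) {A B : Set S} (hAB : Disjoint A B)
    {a b a₁ b₁ : S}
    (ha : a ∈ A) (hb : b ∈ B) (ha₁ : a₁ ∈ A) (hb₁ : b₁ ∈ B)
    (hba : b < a) (hmax : ∀ a' ∈ A, ∀ b' ∈ B, b' < a' → T b' a' ≤ T b a)
    (h₁ : a₁ < b₁) (hT₁ : T a₁ b₁ < T b a) :
    ∃ a' ∈ A, ∃ b' ∈ B, b' < a' ∧ T b' a' = T b a ∧
      ((∃ x ∈ A, x < b' ∧ T x b' < T b a) ∨ ∃ y ∈ B, a' < y ∧ T a' y < T b a) := by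
  have hne : a₁ ≠ b := fun h => Set.disjoint_left.mp hAB ha₁ (h ▸ hb)
  have hne' : a ≠ b₁ := fun h => Set.disjoint_left.mp hAB ha (h ▸ hb₁)
  by_contra! hcon
  -- The pairs `(b₁, a)` and `(b, a₁)` share a vertex with `a₁ < b₁`, so neither is a last decreasing
  -- pair; this contradicts betweenness for `a, b, a₁, b₁` in each of their possible orders.
  have k₁ := hcon a ha b hb hba rfl
  have k₂ := hcon a ha b₁ hb₁
  have k₃ := hcon a₁ ha₁ b hb
  have e₁ := hmax a ha b₁ hb₁
  have e₂ := hmax a₁ ha₁ b hb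
  have f₁ := k₁.1 a₁ ha₁
  have f₂ := k₁.2 b₁ hb₁
  have g₂ : b₁ < a → T b₁ a ≠ T b a := fun h h' => by
    have := (k₂ h h').1 a₁ ha₁ h₁; omega
  have g₃ : b < a₁ → T b a₁ ≠ T b a := fun h h' => by
    have := (k₃ h h').2 b₁ hb₁ h₁; omega
  have l := hT.le_max
  have n := hT.min_le
  rcases hne.lt_or_gt with h | h <;> rcases hne'.lt_or_gt with h' | h'
  · have := n a₁ b b₁ h (hba.trans h')
    have := n b a b₁ hba h'
    have := f₁ h
    have := f₂ h'
    omega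
  · have := f₁ h
    have := e₁ h'
    have := g₂ h'
    rcases lt_trichotomy b b₁ with q | rfl | q
    · have := n a₁ b b₁ h q
      have := l b b₁ a q h'
      omega
    · omega
    · have := l a₁ b₁ b h₁ q
      have := n b₁ b a q hba
      omega
  · have := f₂ h'
    have := e₂ h
    have := g₃ h
    rcases lt_trichotomy a a₁ with q | rfl | q
    · have := l a a₁ b₁ q h₁
      have := n b a a₁ hba q
      omega
    · omega
    · have := n a₁ a b₁ q h'
      have := l b a₁ a h q
      omega
  · have := e₁ h'
    have := e₂ h
    have := g₂ h'
    have := g₃ h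
    have := l b a₁ b₁ h h₁
    have := l b b₁ a (h.trans h₁) h'
    omega

/-- The reduction to four vertices when the last decreasing pair is swapped no later than some
increasing pair. -/
theorem exists_overlap_of_max {T : S → S → ℕ} (hT : IsBetween T) {A B : Set S} (hAB : Disjoint A B)
    {a b a₁ b₁ a₂ b₂ : S}
    (ha : a ∈ A) (hb : b ∈ B) (ha₁ : a₁ ∈ A) (hb₁ : b₁ ∈ B) (ha₂ : a₂ ∈ A) (hb₂ : b₂ ∈ B)
    (hba : b < a) (hmax : ∀ a' ∈ A, ∀ b' ∈ B, b' < a' → T b' a' ≤ T b a)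
    (h₁ : a₁ < b₁) (hT₁ : T a₁ b₁ < T b a) (h₂ : a₂ < b₂) (hT₂ : T b a ≤ T a₂ b₂) :
    ∃ D : Set S, D.ncard ≤ 4 ∧ Overlap T (A ∩ D) (B ∩ D) ∧ Overlap T (B ∩ D) (A ∩ D) := by
  obtain ⟨a, ha, b, hb, hba', hab, h⟩ := exists_shared_endpoint hT hAB ha hb ha₁ hb₁ hba hmax h₁ hT₁
  rw [← hab] at hmax h hT₂
  have hne : ∀ x ∈ A, ∀ y ∈ B, x ≠ y := fun x hx y hy h => Set.disjoint_left.mp hAB hx (h ▸ hy)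
  rcases h with ⟨x, hx, hxb, hTx⟩ | ⟨y, hy, hay, hTy⟩
  · exact exists_overlap_of_shared ha hb hx ha₂ hb₂ (hne _ ha₂ _ hb) (hne _ ha _ hb₂) hba'
      hmax hxb hTx h₂ hT₂
  -- Reversing the order and exchanging `A` and `B` preserves increasing and decreasing pairs.
  · obtain ⟨D, hD, ⟨b₃, hb₃, a₃, ha₃, b₄, hb₄, a₄, ha₄, h₃, h₄, h₅⟩,
      ⟨a₅, ha₅, b₅, hb₅, a₆, ha₆, b₆, hb₆, h₆, h₇, h₈⟩⟩ :=
      exists_overlap_of_shared (S := Sᵒᵈ) (T := fun x y => T (OrderDual.ofDual y) (OrderDual.ofDual x))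
        (A := B) (B := A) (a := b) (b := a) (a₁ := y) (a₂ := b₂) (b₂ := a₂) hb ha hy hb₂ ha₂
        (hne _ ha _ hb₂).symm (hne _ ha₂ _ hb).symm hba' (fun b' hb' a' ha' h => hmax a' ha' b' hb' h) hay hTy h₂ hT₂
    exact ⟨D, hD, ⟨a₃, ha₃, b₃, hb₃, a₄, ha₄, b₄, hb₄, h₃, h₄, h₅⟩,
      ⟨b₅, hb₅, a₅, ha₅, b₆, hb₆, a₆, ha₆, h₆, h₇, h₈⟩⟩

/-- Kirchberger's theorem for swap times. -/
theorem exists_overlap_ncard_le_four [Finite S] {T : S → S → ℕ} (hT : IsBetween T) {A B : Set S}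
    (hAB : Disjoint A B)
    (h₁ : ∃ a ∈ A, ∃ b ∈ B, ∃ a' ∈ A, ∃ b' ∈ B, a < b ∧ b' < a' ∧ T b' a' < T a b)
    (h₂ : ∃ b ∈ B, ∃ a ∈ A, ∃ b' ∈ B, ∃ a' ∈ A, b < a ∧ a' < b' ∧ T a' b' < T b a) :
    ∃ D : Set S, D.ncard ≤ 4 ∧ Overlap T (A ∩ D) (B ∩ D) ∧ Overlap T (B ∩ D) (A ∩ D) := by
  obtain ⟨a₁, ha₁, b₁, hb₁, a₂, ha₂, b₂, hb₂, h₁, h₁', hT₁⟩ := h₁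
  obtain ⟨b₃, hb₃, a₃, ha₃, b₄, hb₄, a₄, ha₄, h₃, h₃', hT₃⟩ := h₂
  obtain ⟨⟨a, b⟩, ⟨ha, hb, hab⟩, hF⟩ := Set.exists_max_image
    {p : S × S | p.1 ∈ A ∧ p.2 ∈ B ∧ p.1 < p.2} (fun p => T p.1 p.2) (Set.toFinite _)
    ⟨(a₁, b₁), ha₁, hb₁, h₁⟩
  obtain ⟨⟨b', a'⟩, ⟨hb', ha', hba'⟩, hI⟩ := Set.exists_max_image
    {p : S × S | p.1 ∈ B ∧ p.2 ∈ A ∧ p.1 < p.2} (fun p => T p.1 p.2) (Set.toFinite _)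
    ⟨(b₃, a₃), hb₃, ha₃, h₃⟩
  have e₁ : T a₁ b₁ ≤ T a b := hF (a₁, b₁) ⟨ha₁, hb₁, h₁⟩
  have e₂ : T b₃ a₃ ≤ T b' a' := hI (b₃, a₃) ⟨hb₃, ha₃, h₃⟩
  rcases le_total (T b' a') (T a b) with h | h
  · exact exists_overlap_of_max hT hAB ha' hb' ha₄ hb₄ ha hb hba'
      (fun x hx y hy hxy => hI (y, x) ⟨hy, hx, hxy⟩) h₃' (hT₃.trans_le e₂) hab h
  · obtain ⟨D, hD, hD₁, hD₂⟩ := exists_overlap_of_max hT hAB.symm hb ha hb₂ ha₂ hb' ha' hab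
      (fun x hx y hy hxy => hF (y, x) ⟨hy, hx, hxy⟩) h₁' (hT₁.trans_le e₁) hba' h
    exact ⟨D, hD, hD₂, hD₁⟩

end Kirchberger

/-! ### Swap times of an ABA-free family -/

section SwapTimes

variable {S : Type*} [LinearOrder S] {G : Set (Set S)}

/-- A positive integer that strictly increases along the slope order of `G`: one more than the number
of predecessors. -/
noncomputable def slopeIndex (G : Set (Set S)) (X : Set S) : ℕ :=
  {Z ∈ G | SlopeLT (· < ·) Z X}.ncard + 1

/-- The largest index of a member of `G` that contains `y` but not `x`; it is `0`, less than every
index, if there is none. For `x < y` all these members precede those that contain `x` but not `y`. -/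
noncomputable def swapTime (G : Set (Set S)) (x y : S) : ℕ :=
  sSup (slopeIndex G '' {X ∈ G | x ∉ X ∧ y ∈ X})

variable [Finite S]

theorem slopeIndex_lt (hG : ABAFree (· < ·) G) {X Y : Set S} (hX : X ∈ G) (hY : Y ∈ G)
    (h : SlopeLT (· < ·) X Y) : slopeIndex G X < slopeIndex G Y := by
  have hss : {Z ∈ G | SlopeLT (· < ·) Z X} ⊂ {Z ∈ G | SlopeLT (· < ·) Z Y} := by
    refine ⟨fun Z hZ => ⟨hZ.1, hZ.2.trans hG hZ.1 hX hY h⟩, fun hsub => ?_⟩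
    have hXX := (hsub ⟨hX, h⟩).2
    exact hXX.asymm hG hX hX hXX
  exact Nat.add_lt_add_right (Set.ncard_lt_ncard hss (Set.toFinite _)) 1

theorem le_swapTime {X : Set S} (hX : X ∈ G) {x y : S} (hx : x ∉ X) (hy : y ∈ X) :
    slopeIndex G X ≤ swapTime G x y :=
  le_csSup (Set.toFinite _).bddAbove ⟨X, ⟨hX, hx, hy⟩, rfl⟩

theorem swapTime_eq_zero_or (G : Set (Set S)) (x y : S) :
    swapTime G x y = 0 ∨ ∃ X ∈ G, x ∉ X ∧ y ∈ X ∧ swapTime G x y = slopeIndex G X := by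
  rcases (slopeIndex G '' {X ∈ G | x ∉ X ∧ y ∈ X}).eq_empty_or_nonempty with h | h
  · left
    rw [swapTime, h, csSup_empty, bot_eq_zero]
  · obtain ⟨X, ⟨hX, hx, hy⟩, h⟩ := Nat.sSup_mem h (Set.toFinite _).bddAbove
    exact .inr ⟨X, hX, hx, hy, h.symm⟩

theorem swapTime_lt (hG : ABAFree (· < ·) G) {X : Set S} (hX : X ∈ G) {x y : S} (hxy : x < y)
    (hx : x ∈ X) (hy : y ∉ X) : swapTime G x y < slopeIndex G X := by
  rcases swapTime_eq_zero_or G x y with h | ⟨Y, hY, hxY, hyY, h⟩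
  · rw [h]
    exact Nat.succ_pos _
  · rw [h]
    exact slopeIndex_lt hG hY hX ⟨x, y, hxy, ⟨hx, hxY⟩, hyY, hy⟩

theorem isBetween_swapTime (hG : ABAFree (· < ·) G) : IsBetween (swapTime G) where
  le_max x y z hxy hyz := by
    rcases swapTime_eq_zero_or G x z with h | ⟨X, hX, hx, hz, h⟩
    · simp [h]
    · rw [h, le_max_iff]
      by_cases hy : y ∈ X
      · exact .inl (le_swapTime hX hx hy)
      · exact .inr (le_swapTime hX hy hz)
  min_le x y z hxy hyz := by
    rcases swapTime_eq_zero_or G x y with h | ⟨X, hX, hxX, hyX, hTX⟩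
    · simp [h]
    rcases swapTime_eq_zero_or G y z with h | ⟨Y, hY, hyY, hzY, hTY⟩
    · simp [h]
    rw [hTX, hTY, min_le_iff]
    by_cases hz : z ∈ X
    · exact .inl (le_swapTime hX hxX hz)
    by_cases hx : x ∈ Y
    · exact absurd ⟨x, y, z, hxy, hyz, ⟨hx, hxX⟩, ⟨hzY, hz⟩, hyX, hyY⟩ (hG Y hY X hX)
    · exact .inr (le_swapTime hY hx hzY)

theorem isCut_slopeIndex_lt (hG : ABAFree (· < ·) G) (q : ℕ) :
    IsCut G {X | slopeIndex G X < q} := fun _ hX _ hY h hYq =>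
  (slopeIndex_lt hG hX hY h).trans hYq

theorem IsMaximalABAFree.exists_swapTime_lt (hG : IsMaximalABAFree G) {A B : Set S}
    (hAB : Disjoint A B) (hsep : ∀ X ∈ G, A ⊆ X → (X ∩ B).Nonempty) :
    ∃ a ∈ A, ∃ b ∈ B, ∃ a' ∈ A, ∃ b' ∈ B, a < b ∧ b' < a' ∧
      swapTime G b' a' < swapTime G a b := by
  -- The cut just before the index `q`.
  have key : ∀ q, ∃ a ∈ A, ∃ b ∈ B,
      (a < b ∧ q ≤ swapTime G a b) ∨ (b < a ∧ swapTime G b a + 1 < q) := by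
    intro q
    obtain ⟨a, ha, b, hb, ⟨hab, X, hX, hXq, haX, hbX⟩ | ⟨hba, X, hX, hXq, hbX, haX⟩⟩ :=
      hG.exists_cutRel (isCut_slopeIndex_lt hG.abaFree q) hAB hsep
    · exact ⟨a, ha, b, hb, .inl ⟨hab, (not_lt.mp hXq).trans (le_swapTime hX haX hbX)⟩⟩
    · exact ⟨a, ha, b, hb, .inr ⟨hba, lt_of_le_of_lt
        (Nat.succ_le_of_lt (swapTime_lt hG.abaFree hX hba hbX haX)) hXq⟩⟩
  obtain ⟨a₀, ha₀, b₀, hb₀, ⟨h₀, -⟩ | ⟨-, h₀⟩⟩ := key 0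
  · obtain ⟨⟨a, b⟩, ⟨ha, hb, hab⟩, hmax⟩ := Set.exists_max_image
      {p : S × S | p.1 ∈ A ∧ p.2 ∈ B ∧ p.1 < p.2} (fun p => swapTime G p.1 p.2) (Set.toFinite _)
      ⟨(a₀, b₀), ha₀, hb₀, h₀⟩
    obtain ⟨a', ha', b', hb', ⟨h, hq⟩ | ⟨h, hq⟩⟩ := key (swapTime G a b + 1)
    · exact absurd (hmax (a', b') ⟨ha', hb', h⟩) (not_le.mpr hq)
    · exact ⟨a, ha, b, hb, a', ha', b', hb', hab, h, by omega⟩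
  · omega

theorem Overlap.inter_nonempty (hG : ABAFree (· < ·) G) {A B : Set S}
    (h : Overlap (swapTime G) A B) {X : Set S} (hX : X ∈ G) (hA : A ⊆ X) : (X ∩ B).Nonempty := by
  by_contra hne
  have hB : ∀ b ∈ B, b ∉ X := fun b hb hbX => hne ⟨b, hbX, hb⟩
  obtain ⟨a, ha, b, hb, a', ha', b', hb', hab, hba, hT⟩ := h
  have h₁ := swapTime_lt hG hX hab (hA ha) (hB b hb)
  have h₂ := le_swapTime hX (hB b' hb') (hA ha')
  omega

/-- Kirchberger's theorem: if `A` and `B` are not separated by a member of a maximal family, then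
neither are their traces on some set of at most four vertices. -/
theorem IsMaximalABAFree.exists_ncard_le_four (hG : IsMaximalABAFree G) {A B : Set S} (hAB : Disjoint A B)
    (hsep : ∀ X ∈ G, ¬ Separates X A B) :
    ∃ D : Set S, D.ncard ≤ 4 ∧ ∀ X ∈ G, ¬ Separates X (A ∩ D) (B ∩ D) := by
  have h₁ : ∀ X ∈ G, A ⊆ X → (X ∩ B).Nonempty := fun X hX hA =>
    Set.nonempty_iff_ne_empty.mpr fun h => hsep X hX (.inl ⟨hA, h⟩)
  have h₂ : ∀ X ∈ G, B ⊆ X → (X ∩ A).Nonempty := fun X hX hB =>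
    Set.nonempty_iff_ne_empty.mpr fun h => hsep X hX (.inr ⟨h, hB⟩)
  obtain ⟨D, hD, hD₁, hD₂⟩ := exists_overlap_ncard_le_four (isBetween_swapTime hG.abaFree) hAB
    (hG.exists_swapTime_lt hAB h₁) (hG.exists_swapTime_lt hAB.symm h₂)
  refine ⟨D, hD, fun X hX h => ?_⟩
  rcases h with ⟨hA, hB⟩ | ⟨hA, hB⟩
  · exact (hD₁.inter_nonempty hG.abaFree hX hA).ne_empty hB
  · exact (hD₂.inter_nonempty hG.abaFree hX hB).ne_empty hA

end SwapTimes

/-! ### Common points of two hulls -/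

section Vertex

variable {S : Type*} [LinearOrder S] {G : Set (Set S)} {K : Set S}

/-- For a lower set `K` of vertices, `BelowAt K X Y` says that the curve of `Y` is forced to be below
the curve of `X` at the position between `K` and its complement: a new vertex in that position
lies in `Y` if it lies in `X`. -/
def BelowAt (K X Y : Set S) : Prop :=
  (∃ i ∈ K, ∃ j ∉ K, i ∈ Y \ X ∧ j ∈ Y \ X) ∨
  (∃ i j, i < j ∧ j ∈ K ∧ i ∈ X \ Y ∧ j ∈ Y \ X) ∨
  (∃ i j, i < j ∧ i ∉ K ∧ i ∈ Y \ X ∧ j ∈ X \ Y)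

/-- The cyclic rotation of the vertex order that moves the lower set `K` behind its complement. -/
def rotatedLT (K : Set S) (x y : S) : Prop := (x ∉ K ∧ y ∈ K) ∨ (x < y ∧ (x ∈ K ↔ y ∈ K))

instance (K : Set S) : IsStrictTotalOrder S (rotatedLT K) where
  trichotomous x y h₁ h₂ := by
    unfold rotatedLT at h₁ h₂
    rcases lt_trichotomy x y with h | h | h <;> tauto
  irrefl x h := by
    unfold rotatedLT at h
    have := lt_irrefl x
    tauto
  trans x y z h₁ h₂ := by
    unfold rotatedLT at *
    have : x < y → y < z → x < z := lt_trans
    tauto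

/-- Rotating the vertex order and flipping the rotated vertices preserves ABA-freeness. -/
theorem ABAFree.rotate (hG : ABAFree (· < ·) G) (hK : IsLowerSet K) :
    ABAFree (rotatedLT K) ((symmDiff · K) '' G) := by
  rintro _ ⟨X, hX, rfl⟩ _ ⟨Y, hY, rfl⟩ ⟨x, y, z, hxy, hyz, hx, hz, hy⟩
  have hXY := hG X hX Y hY
  have hYX := hG Y hY X hX
  have hlt : ∀ {i j}, i ∈ K → j ∉ K → i < j := fun hi hj =>
    lt_of_not_ge fun h => hj (hK h hi)
  have hin : ∀ {i} {V W : Set S}, i ∈ K → i ∈ symmDiff V K \ symmDiff W K → i ∈ W \ V := by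
    simp only [Set.mem_sdiff, Set.mem_symmDiff]
    tauto
  have hout : ∀ {i} {V W : Set S}, i ∉ K → i ∈ symmDiff V K \ symmDiff W K → i ∈ V \ W := by
    simp only [Set.mem_sdiff, Set.mem_symmDiff]
    tauto
  rcases hxy with ⟨hxK, hyK⟩ | ⟨hxy, hxyK⟩ <;> rcases hyz with ⟨hyK', hzK⟩ | ⟨hyz, hyzK⟩
  · exact hyK' hyK
  · have hzK := hyzK.mp hyK
    exact hXY ⟨y, z, x, hyz, hlt hzK hxK, hin hyK hy, hout hxK hx, hin hzK hz⟩
  · have hxK := mt hxyK.mp hyK'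
    exact hYX ⟨z, x, y, hlt hzK hxK, hxy, hin hzK hz, hout hyK' hy, hout hxK hx⟩
  · by_cases hyK : y ∈ K
    · exact hYX ⟨x, y, z, hxy, hyz, hin (hxyK.mpr hyK) hx, hin (hyzK.mp hyK) hz, hin hyK hy⟩
    · exact hXY ⟨x, y, z, hxy, hyz, hout (mt hxyK.mp hyK) hx, hout (mt hyzK.mpr hyK) hz,
        hout hyK hy⟩

/-- After the rotation the new position is the first one, and there the vertical order of the curves
is their slope order. -/
theorem belowAt_iff (hK : IsLowerSet K) {X Y : Set S} :
    BelowAt K X Y ↔ SlopeLT (rotatedLT K) (symmDiff X K) (symmDiff Y K) := by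
  have hlt : ∀ {i j}, i ∈ K → j ∉ K → i < j := fun hi hj =>
    lt_of_not_ge fun h => hj (hK h hi)
  constructor
  · rintro (⟨i, hi, j, hj, hiY, hjY⟩ | ⟨i, j, hij, hj, hiX, hjY⟩ | ⟨i, j, hij, hi, hiY, hjX⟩)
    · exact ⟨j, i, .inl ⟨hj, hi⟩, by simp_all [Set.mem_symmDiff], by simp_all [Set.mem_symmDiff]⟩
    · have hi := hK hij.le hj
      exact ⟨i, j, .inr ⟨hij, by simp [*]⟩, by simp_all [Set.mem_symmDiff],
        by simp_all [Set.mem_symmDiff]⟩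
    · have hj : j ∉ K := fun h => hi (hK hij.le h)
      exact ⟨i, j, .inr ⟨hij, by simp [*]⟩, by simp_all [Set.mem_symmDiff],
        by simp_all [Set.mem_symmDiff]⟩
  · rintro ⟨i, j, ⟨hi, hj⟩ | ⟨hij, hK⟩, hiY, hjX⟩
    · exact .inl ⟨j, hj, i, hi, by simp_all [Set.mem_symmDiff], by simp_all [Set.mem_symmDiff]⟩
    · by_cases hj : j ∈ K
      · exact .inr (.inl ⟨i, j, hij, hj, by simp_all [Set.mem_symmDiff],
          by simp_all [Set.mem_symmDiff]⟩)
      · exact .inr (.inr ⟨i, j, hij, by simp_all, by simp_all [Set.mem_symmDiff],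
          by simp_all [Set.mem_symmDiff]⟩)

theorem BelowAt.trans (hG : ABAFree (· < ·) G) (hK : IsLowerSet K) {X Y Z : Set S} (hX : X ∈ G)
    (hY : Y ∈ G) (hZ : Z ∈ G) (h₁ : BelowAt K X Y) (h₂ : BelowAt K Y Z) : BelowAt K X Z := by
  rw [belowAt_iff hK] at *
  exact h₁.trans (hG.rotate hK) (Set.mem_image_of_mem _ hX) (Set.mem_image_of_mem _ hY)
    (Set.mem_image_of_mem _ hZ) h₂

theorem BelowAt.irrefl {X : Set S} : ¬ BelowAt K X X := by
  simp [BelowAt]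

/-- A new vertex can be added to `G` in the hulls of both `A` and `B` (taken with respect to all
members of `G` and their complements): `K` consists of the vertices before it, and `P` tells which
members of `G` receive it. -/
def HasCommonPoint (G : Set (Set S)) (A B : Set S) : Prop :=
  ∃ (K : Set S) (P : Set S → Prop), IsLowerSet K ∧
    (∀ X ∈ G, ∀ Y ∈ G, P X → BelowAt K X Y → P Y) ∧
    ∀ X ∈ G, (A ⊆ X ∨ B ⊆ X → P X) ∧ (X ∩ A = ∅ ∨ X ∩ B = ∅ → ¬ P X)

theorem HasCommonPoint.symm {A B : Set S} (h : HasCommonPoint G A B) : HasCommonPoint G B A := by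
  obtain ⟨K, P, hK, hP, h⟩ := h
  exact ⟨K, P, hK, hP, fun X hX => ⟨fun h' => (h X hX).1 h'.symm, fun h' => (h X hX).2 h'.symm⟩⟩

/-- The crossing point of the segments `a a'` and `b b'`. It is placed between the vertices above only
the line `W₁` through `a, a'` and those above only the line `W₂` through `b, b'`; a set receives it if
it is forced to by a set that contains one of the segments. Were such a set to miss the other
segment, then one of the two lines would be strictly below the other at this position. -/
theorem hasCommonPoint_of_lines (hG : ABAFree (· < ·) G) {W₁ W₂ : Set S} {a a' b b' : S}
    (hW₁ : W₁ ∈ G) (hW₁' : insert a (insert a' W₁) ∈ G) (hU₁ : insert a W₁ ∈ G)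
    (hW₂ : W₂ ∈ G) (hW₂' : insert b (insert b' W₂) ∈ G) (hU₂ : insert b' W₂ ∈ G)
    (ha₁ : a ∉ W₁) (ha'₁ : a' ∉ W₁) (hb₁ : b ∈ W₁) (hb'₁ : b' ∉ W₁)
    (hb₂ : b ∉ W₂) (hb'₂ : b' ∉ W₂) (ha₂ : a ∉ W₂) (ha'₂ : a' ∈ W₂) (hab' : a ≠ b') (haa' : a < a') :
    HasCommonPoint G {a, a'} {b, b'} := by
  suffices h : ∃ (K : Set S) (P : Set S → Prop), IsLowerSet K ∧
      (∀ X ∈ G, ∀ Y ∈ G, P X → BelowAt K X Y → P Y) ∧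
      (∀ X ∈ G, a ∈ X → a' ∈ X → P X) ∧ (∀ X ∈ G, b ∈ X → b' ∈ X → P X) ∧
      (∀ X ∈ G, a ∉ X → a' ∉ X → ¬ P X) ∧ (∀ X ∈ G, b ∉ X → b' ∉ X → ¬ P X) by
    obtain ⟨K, P, hK, hP, h₁, h₂, h₃, h₄⟩ := h
    refine ⟨K, P, hK, hP, fun X hX => ⟨?_, ?_⟩⟩
    · rintro (h | h)
      · exact h₁ X hX (h (by simp)) (h (by simp))
      · exact h₂ X hX (h (by simp)) (h (by simp))
    · rintro (h | h)
      · exact h₃ X hX (fun ha => h.le ⟨ha, by simp⟩) fun ha => h.le ⟨ha, by simp⟩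
      · exact h₄ X hX (fun hb => h.le ⟨hb, by simp⟩) fun hb => h.le ⟨hb, by simp⟩
  have ha : a ∈ insert a W₁ \ insert b' W₂ := by grind
  have ha' : a' ∈ insert b' W₂ \ insert a W₁ := by grind
  have hb : b ∈ insert a W₁ \ insert b' W₂ := by grind
  have hb' : b' ∈ insert b' W₂ \ insert a W₁ := by grind
  let K : Set S := {x | ∃ y ∈ insert a W₁ \ insert b' W₂, x ≤ y}
  have hK : IsLowerSet K := fun x y hyx ⟨z, hz, hxz⟩ => ⟨z, hz, hyx.trans hxz⟩
  have hin : ∀ x ∈ insert a W₁ \ insert b' W₂, x ∈ K := fun x hx => ⟨x, hx, le_rfl⟩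
  have hout : ∀ x ∈ insert b' W₂ \ insert a W₁, x ∉ K := by
    rintro x hx ⟨y, hy, hxy⟩
    rcases lt_trichotomy x a with h | rfl | h
    · exact hG _ hU₂ _ hU₁ ⟨x, a, a', h, haa', hx, ha', ha⟩
    · exact hx.2 ha.1
    · refine hG _ hU₁ _ hU₂ ⟨a, x, y, h, lt_of_le_of_ne hxy ?_, ha, hy, hx⟩
      rintro rfl
      exact hx.2 hy.1
  have h₁ : ¬ BelowAt K W₁ (insert b (insert b' W₂)) := by
    rintro (⟨i, hi, -, -, hi', -⟩ | ⟨-, j, -, hj, -, hj'⟩ | ⟨i, j, hij, hi, -, hj⟩)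
    · exact hout i (by grind) hi
    · exact hout j (by grind) hj
    · exact hi (hK hij.le (hin j (by grind)))
  have h₂ : ¬ BelowAt K W₂ (insert a (insert a' W₁)) := by
    rintro (⟨-, -, j, hj, -, hj'⟩ | ⟨i, j, hij, hj, hi, -⟩ | ⟨i, -, -, hi, hi', -⟩)
    · exact hj (hin j (by grind))
    · exact hout i (by grind) (hK hij.le hj)
    · exact hi (hin i (by grind))
  have hA : ∀ {X Y : Set S}, a ∈ Y → a' ∈ Y → a ∉ X → a' ∉ X → BelowAt K X Y :=
    fun h h' k k' => .inl ⟨a, hin a ha, a', hout a' ha', ⟨h, k⟩, h', k'⟩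
  have hB : ∀ {X Y : Set S}, b ∈ Y → b' ∈ Y → b ∉ X → b' ∉ X → BelowAt K X Y :=
    fun h h' k k' => .inl ⟨b, hin b hb, b', hout b' hb', ⟨h, k⟩, h', k'⟩
  have trans : ∀ {X Y Z}, X ∈ G → Y ∈ G → Z ∈ G → BelowAt K X Y → BelowAt K Y Z → BelowAt K X Z :=
    fun hX hY hZ => BelowAt.trans hG hK hX hY hZ
  refine ⟨K, fun Z => ∃ X ∈ G, (a ∈ X ∧ a' ∈ X ∨ b ∈ X ∧ b' ∈ X) ∧ (X = Z ∨ BelowAt K X Z), hK,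
    ?_, fun X hX h h' => ⟨X, hX, .inl ⟨h, h'⟩, .inl rfl⟩,
    fun X hX h h' => ⟨X, hX, .inr ⟨h, h'⟩, .inl rfl⟩, ?_, ?_⟩
  · rintro X hX Y hY ⟨Z, hZ, hZ', rfl | hZX⟩ hXY
    · exact ⟨Z, hZ, hZ', .inr hXY⟩
    · exact ⟨Z, hZ, hZ', .inr (trans hZ hX hY hZX hXY)⟩
  · rintro Y hY haY ha'Y ⟨X, hX, ⟨haX, ha'X⟩ | ⟨hbX, hb'X⟩, hXY⟩
    · rcases hXY with rfl | hXY
      · exact haY haX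
      · exact BelowAt.irrefl (trans hX hY hX hXY (hA haX ha'X haY ha'Y))
    · have hWX : BelowAt K W₂ X := hB hbX hb'X hb₂ hb'₂
      have hYW : BelowAt K Y (insert a (insert a' W₁)) := hA (by simp) (by simp) haY ha'Y
      rcases hXY with rfl | hXY
      · exact h₂ (trans hW₂ hX hW₁' hWX hYW)
      · exact h₂ (trans hW₂ hX hW₁' hWX (trans hX hY hW₁' hXY hYW))
  · rintro Y hY hbY hb'Y ⟨X, hX, ⟨haX, ha'X⟩ | ⟨hbX, hb'X⟩, hXY⟩
    · have hWX : BelowAt K W₁ X := hA haX ha'X ha₁ ha'₁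
      have hYW : BelowAt K Y (insert b (insert b' W₂)) := hB (by simp) (by simp) hbY hb'Y
      rcases hXY with rfl | hXY
      · exact h₁ (trans hW₁ hX hW₂' hWX hYW)
      · exact h₁ (trans hW₁ hX hW₂' hWX (trans hX hY hW₂' hXY hYW))
    · rcases hXY with rfl | hXY
      · exact hbY hbX
      · exact BelowAt.irrefl (trans hX hY hX hXY (hB hbX hb'X hbY hb'Y))

/-- The new vertex is a twin of `b`, placed right after it. -/
theorem hasCommonPoint_singleton (hG : ABAFree (· < ·) G) {A : Set S} {b : S}
    (hsep : ∀ X ∈ G, ¬ Separates X A {b}) : HasCommonPoint G A {b} := by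
  refine ⟨Set.Iic b, fun X => b ∈ X, isLowerSet_Iic b, ?_, fun X hX => ⟨?_, ?_⟩⟩
  · rintro X hX Y hY hbX h
    by_contra hbY
    have hne : ∀ {i}, i ∈ Y \ X → i ≠ b := fun hi h => hbY (h ▸ hi.1)
    rcases h with ⟨i, hi, j, hj, hiY, hjY⟩ | ⟨i, j, hij, hj, hiX, hjY⟩ | ⟨i, j, hij, hi, hiY, hjX⟩
    · exact hG Y hY X hX ⟨i, b, j, lt_of_le_of_ne hi (hne hiY), not_le.mp hj, hiY, hjY, hbX, hbY⟩
    · exact hG X hX Y hY ⟨i, j, b, hij, lt_of_le_of_ne hj (hne hjY), hiX, ⟨hbX, hbY⟩, hjY⟩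
    · exact hG X hX Y hY ⟨b, i, j, not_le.mp hi, hij, ⟨hbX, hbY⟩, hjX, hiY⟩
  · rintro (h | h)
    · by_contra hb
      exact hsep X hX (.inl ⟨h, by simpa using hb⟩)
    · exact h rfl
  · rintro (h | h) hb
    · exact hsep X hX (.inr ⟨h, by simpa using hb⟩)
    · exact h.le ⟨hb, rfl⟩

theorem IsMaximalABAFree.hasCommonPoint_pair (hG : IsMaximalABAFree G) {a a' b b' : S}
    (haa' : a ≠ a') (hbb' : b ≠ b') (hAB : Disjoint ({a, a'} : Set S) {b, b'})
    (hsep : ∀ X ∈ G, ¬ Separates X {a, a'} {b, b'}) : HasCommonPoint G {a, a'} {b, b'} := by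
  obtain ⟨W₁, ha₁, ha'₁, hW₁, hU₁, hU₁', hW₁'⟩ := hG.exists_line haa'
  obtain ⟨W₂, hb₂, hb'₂, hW₂, hU₂, hU₂', hW₂'⟩ := hG.exists_line hbb'
  have hne : a ≠ b ∧ a ≠ b' ∧ a' ≠ b ∧ a' ≠ b' := by
    simp only [Set.disjoint_insert_left, Set.disjoint_singleton_left, Set.mem_insert_iff,
      Set.mem_singleton_iff] at hAB
    tauto
  have hone : (b ∈ W₁ ∧ b' ∉ W₁) ∨ (b' ∈ W₁ ∧ b ∉ W₁) := by
    have h := hsep _ hW₁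
    have h' := hsep _ hW₁'
    simp only [Separates, Set.insert_subset_iff, Set.singleton_subset_iff,
      Set.eq_empty_iff_forall_notMem] at h h'
    grind
  have htwo : (a' ∈ W₂ ∧ a ∉ W₂) ∨ (a ∈ W₂ ∧ a' ∉ W₂) := by
    have h := hsep _ hW₂
    have h' := hsep _ hW₂'
    simp only [Separates, Set.insert_subset_iff, Set.singleton_subset_iff,
      Set.eq_empty_iff_forall_notMem] at h h'
    grind
  clear hsep hAB
  wlog hb : b ∈ W₁ ∧ b' ∉ W₁ generalizing b b'
  · rw [Set.pair_comm b b']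
    exact this hbb'.symm hb'₂ hb₂ hU₂' hU₂ (by rwa [Set.insert_comm]) (by tauto) (by tauto)
      (by tauto)
  wlog ha : a' ∈ W₂ ∧ a ∉ W₂ generalizing a a'
  · rw [Set.pair_comm a a']
    exact this haa'.symm ha'₁ ha₁ hU₁' hU₁ (by rwa [Set.insert_comm]) (by tauto) (by tauto)
      (by tauto)
  obtain ⟨hab, hab', ha'b, ha'b'⟩ := hne
  rcases haa'.lt_or_gt with h | h
  · exact hasCommonPoint_of_lines hG.abaFree hW₁ hW₁' hU₁ hW₂ hW₂' hU₂' ha₁ ha'₁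
      hb.1 hb.2 hb₂ hb'₂ ha.2 ha.1 hab' h
  · have hP : a ∈ insert a W₁ \ insert b' W₂ := by grind
    have hQ : a' ∈ insert b' W₂ \ insert a W₁ := by grind
    have hP' : b ∈ insert a W₁ \ insert b' W₂ := by grind
    have hQ' : b' ∈ insert b' W₂ \ insert a W₁ := by grind
    have hb'b : b' < b := by
      by_contra hlt
      have hlt := lt_of_le_of_ne (not_lt.mp hlt) hbb'
      rcases hab'.lt_or_gt with h' | h'
      · exact hG.abaFree _ hU₂' _ hU₁ ⟨a', a, b', h, h', hQ, hQ', hP⟩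
      · exact hG.abaFree _ hU₁ _ hU₂' ⟨b, b', a, hlt, h', hP', hP, hQ'⟩
    rw [Set.pair_comm a a', Set.pair_comm b b']
    exact (hasCommonPoint_of_lines hG.abaFree hW₂ (by rwa [Set.insert_comm]) hU₂' hW₁
      (by rwa [Set.insert_comm]) hU₁ hb'₂ hb₂ ha.1 ha.2 ha'₁ ha₁ hb.2 hb.1 hab'.symm hb'b).symm

theorem IsMaximalABAFree.hasCommonPoint [Finite S] (hG : IsMaximalABAFree G) {A B : Set S}
    (hAB : Disjoint A B) (hcard : A.ncard + B.ncard ≤ 4) (hsep : ∀ X ∈ G, ¬ Separates X A B) :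
    HasCommonPoint G A B := by
  have hempty : ∅ ∈ G := hG.mem_of_insert _ (hG.abaFree.insert_of_closed (C := ∅) (by simp))
  have hA : A.ncard ≠ 0 := by
    rw [Ne, Set.ncard_eq_zero]
    rintro rfl
    exact hsep ∅ hempty (.inl ⟨subset_rfl, by simp⟩)
  have hB : B.ncard ≠ 0 := by
    rw [Ne, Set.ncard_eq_zero]
    rintro rfl
    exact hsep ∅ hempty (.inr ⟨by simp, subset_rfl⟩)
  have hcases : A.ncard = 1 ∨ B.ncard = 1 ∨ (A.ncard = 2 ∧ B.ncard = 2) := by omega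
  rcases hcases with h | h | ⟨h, h'⟩
  · obtain ⟨a, rfl⟩ := Set.ncard_eq_one.mp h
    exact (hasCommonPoint_singleton hG.abaFree fun X hX hX' => hsep X hX
      (hX'.elim (fun h => .inr h.symm) fun h => .inl h.symm)).symm
  · obtain ⟨b, rfl⟩ := Set.ncard_eq_one.mp h
    exact hasCommonPoint_singleton hG.abaFree hsep
  · obtain ⟨a, a', haa', rfl⟩ := Set.ncard_eq_two.mp h
    obtain ⟨b, b', hbb', rfl⟩ := Set.ncard_eq_two.mp h'
    exact hG.hasCommonPoint_pair haa' hbb' hAB hsep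

end Vertex

/-! ### Extension by a new vertex -/

section Extension

variable {S : Type*} [LinearOrder S] {G : Set (Set S)} {K : Set S}

/-- The order on `Option S` in which `none` is inserted right after the lower set `K`. -/
def insertLT (K : Set S) : Option S → Option S → Prop
  | some x, some y => x < y
  | some x, none => x ∈ K
  | none, some y => y ∉ K
  | none, none => False

theorem isStrictTotalOrder_insertLT (hK : IsLowerSet K) :
    IsStrictTotalOrder (Option S) (insertLT K) where
  trichotomous
    | some x, some y => fun h h' => by
      rw [le_antisymm (not_lt.mp h') (not_lt.mp h)]
    | some x, none => fun h h' => (h' h).elim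
    | none, some y => fun h h' => (h h').elim
    | none, none => fun _ _ => rfl
  irrefl
    | some x => lt_irrefl x
    | none => id
  trans
    | some x, some y, some z => lt_trans (a := x) (b := y) (c := z)
    | some x, some y, none => fun h h' => hK (le_of_lt h) h'
    | some x, none, some z => fun h h' => lt_of_not_ge fun hzx => h' (hK hzx h)
    | some x, none, none => fun _ h' => h'.elim
    | none, some y, some z => fun h h' hz => h (hK (le_of_lt h') hz)
    | none, some y, none => fun h h' => h h'
    | none, none, _ => fun h => h.elim

/-- The set `X`, together with the new vertex `none` if `P X` holds. -/
def extendSet (P : Set S → Prop) (X : Set S) : Set (Option S) := {o | o.elim (P X) (· ∈ X)}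

theorem ABAFree.extendSet (hG : ABAFree (· < ·) G) {P : Set S → Prop}
    (hP : ∀ X ∈ G, ∀ Y ∈ G, P X → BelowAt K X Y → P Y) :
    ABAFree (insertLT K) (_root_.extendSet P '' G) := by
  rintro _ ⟨X, hX, rfl⟩ _ ⟨Y, hY, rfl⟩ ⟨x, y, z, hxy, hyz, hx, hz, hy⟩
  match x, y, z with
  | some x, some y, some z => exact hG X hX Y hY ⟨x, y, z, hxy, hyz, hx, hz, hy⟩
  | some x, some y, none => exact hz.2 (hP X hX Y hY hz.1 (.inr (.inl ⟨x, y, hxy, hyz, hx, hy⟩)))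
  | some x, none, some z => exact hy.2 (hP Y hY X hX hy.1 (.inl ⟨x, hxy, z, hyz, hx, hz⟩))
  | some x, none, none => exact hyz
  | none, some y, some z => exact hx.2 (hP X hX Y hY hx.1 (.inr (.inr ⟨y, z, hyz, hxy, hy, hz⟩)))
  | none, some y, none => exact hxy hyz
  | none, none, _ => exact hxy

theorem HasCommonPoint.hasVertexInHulls {H F : Set (Set S)} {A B : Set S}
    (h : HasCommonPoint G A B) (hHF : IsWitness (· < ·) H F)
    (hFG : F ⊆ G) : HasVertexInHulls H F A B := by
  obtain ⟨K, P, hK, hP, h⟩ := h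
  let t := extendSet P
  let b : Set S → Set (Option S) := fun X => (t Xᶜ)ᶜ
  have ht : ∀ X, some ⁻¹' t X = X := fun X => rfl
  have hb : ∀ X, some ⁻¹' b X = X := fun X => by
    simp only [b, Set.preimage_compl, ht, compl_compl]
  -- The trace on `S` recovers the original set, so no topset is accidentally created from a
  -- bottomset or conversely.
  have htop : topsets (t '' topsets H F ∪ b '' bottomsets H F) (t '' F) = t '' topsets H F := by
    ext Z
    constructor
    · rintro ⟨⟨X, hX, rfl⟩ | ⟨Y, hY, rfl⟩, X', hX', hXX'⟩
      · exact ⟨X, hX, rfl⟩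
      · have : X' = Y := by rw [← ht X', hXX', hb]
        subst this
        exact ⟨X', ⟨hY.1, hX'⟩, hXX'⟩
    · rintro ⟨X, hX, rfl⟩
      exact ⟨.inl ⟨X, hX, rfl⟩, X, hX.2, rfl⟩
  have hbot : bottomsets (t '' topsets H F ∪ b '' bottomsets H F) (t '' F) =
      b '' bottomsets H F := by
    ext Z
    constructor
    · rintro ⟨⟨X, hX, rfl⟩ | ⟨Y, hY, rfl⟩, X', hX', hXX'⟩
      · have : X' = Xᶜ := by rw [← ht X', hXX', Set.preimage_compl, ht]
        subst this
        exact ⟨X, ⟨hX.1, hX'⟩, by simp only [b, hXX', compl_compl]⟩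
      · exact ⟨Y, hY, rfl⟩
    · rintro ⟨Y, hY, rfl⟩
      exact ⟨.inr ⟨Y, hY, rfl⟩, Yᶜ, hY.2, (compl_compl _).symm⟩
  refine ⟨insertLT K, t '' topsets H F ∪ b '' bottomsets H F, t '' F,
    ⟨isStrictTotalOrder_insertLT hK, fun _ _ => Iff.rfl, ⟨?_, ?_⟩, t, b, ?_, ?_, fun X _ => ht X,
      fun X _ => hb X, fun X _ _ => by simp only [b, compl_compl]⟩, ?_⟩
  · exact hHF.abaFree.extendSet fun X hX Y hY => hP X (hFG hX) Y (hFG hY)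
  · rintro _ (⟨X, hX, rfl⟩ | ⟨X, hX, rfl⟩)
    · exact .inl ⟨X, hX.2, rfl⟩
    · exact .inr ⟨Xᶜ, hX.2, (compl_compl _).symm⟩
  · rw [htop]
    exact (Function.LeftInverse.injective ht).injOn.bijOn_image
  · rw [hbot]
    exact (Function.LeftInverse.injective hb).injOn.bijOn_image
  · have key : ∀ A' : Set S, (∀ X ∈ G, (A' ⊆ X → P X) ∧ (X ∩ A' = ∅ → ¬ P X)) →
        none ∈ hullOf (t '' topsets H F ∪ b '' bottomsets H F) (some '' A') := by
      rintro A' hA' _ ⟨⟨X, hX, rfl⟩ | ⟨X, hX, rfl⟩, hsub⟩ <;> rw [Set.image_subset_iff] at hsub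
      · rw [ht] at hsub
        exact (hA' X (hFG hX.2)).1 hsub
      · rw [hb] at hsub
        exact (hA' Xᶜ (hFG hX.2)).2 <|
          Set.disjoint_iff_inter_eq_empty.mp (Set.disjoint_compl_left_iff_subset.mpr hsub)
    exact ⟨key A fun X hX => ⟨fun h' => (h X hX).1 (.inl h'), fun h' => (h X hX).2 (.inl h')⟩,
      key B fun X hX => ⟨fun h' => (h X hX).1 (.inr h'), fun h' => (h X hX).2 (.inr h')⟩⟩

theorem hullOf_mono {α : Type*} (H : Set (Set α)) {X Y : Set α} (h : X ⊆ Y) :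
    hullOf H X ⊆ hullOf H Y :=
  Set.sInter_subset_sInter fun _ hZ => ⟨hZ.1, h.trans hZ.2⟩

theorem HasVertexInHulls.mono {H F : Set (Set S)} {A B A' B' : Set S} (hA : A ⊆ A') (hB : B ⊆ B')
    (h : HasVertexInHulls H F A B) : HasVertexInHulls H F A' B' := by
  obtain ⟨lt, Hp, Fp, hext, h⟩ := h
  exact ⟨lt, Hp, Fp, hext, hullOf_mono Hp (Set.image_mono hA) h.1,
    hullOf_mono Hp (Set.image_mono hB) h.2⟩

theorem exists_separator [Finite S] {H F : Set (Set S)} (hHF : IsWitness (· < ·) H F)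
    {A B : Set S} (hAB : Disjoint A B)
    (h : ¬ ∃ D : Set S, D.ncard ≤ 4 ∧ HasVertexInHulls H F (A ∩ D) (B ∩ D)) :
    ∃ G X, F ⊆ G ∧ ABAFree (· < ·) G ∧ X ∈ G ∧ Separates X A B := by
  obtain ⟨G, hFG, hG⟩ := exists_isMaximalABAFree hHF.abaFree
  by_contra! hcon
  obtain ⟨D, hD, hsep⟩ := hG.exists_ncard_le_four hAB fun X hX => hcon G X hFG hG.abaFree hX
  have hdisj : Disjoint (A ∩ D) (B ∩ D) := hAB.mono Set.inter_subset_left Set.inter_subset_left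
  have hcard : (A ∩ D).ncard + (B ∩ D).ncard ≤ 4 := by
    rw [← Set.ncard_union_eq hdisj]
    exact (Set.ncard_le_ncard (Set.union_subset Set.inter_subset_right
      Set.inter_subset_right)).trans hD
  exact h ⟨D, hD, (hG.hasCommonPoint hdisj hcard hsep).hasVertexInHulls hHF hFG⟩

/-- If both `X` and its complement are hyperedges, then the hulls of two sets separated by `X` lie in
complementary hyperedges of every extension. -/
theorem not_hasVertexInHulls_of_separates {H F : Set (Set S)} {A B X : Set S} (hX : X ∈ H)
    (hX' : Xᶜ ∈ H) (hXF : X ∈ F ∨ Xᶜ ∈ F) (hsep : Separates X A B) :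
    ¬ HasVertexInHulls H F A B := by
  wlog hF : X ∈ F generalizing X
  · refine this hX' (by rwa [compl_compl]) (by rw [compl_compl]; exact hXF.symm) ?_
      (hXF.resolve_left hF)
    rcases hsep with ⟨h, h'⟩ | ⟨h, h'⟩
    · exact .inr ⟨Set.disjoint_iff_inter_eq_empty.mp
        (Set.disjoint_compl_left_iff_subset.mpr h),
        (Set.disjoint_iff_inter_eq_empty.mpr h').symm.subset_compl_right⟩
    · exact .inl ⟨(Set.disjoint_iff_inter_eq_empty.mpr h).symm.subset_compl_right,
        Set.disjoint_iff_inter_eq_empty.mp (Set.disjoint_compl_left_iff_subset.mpr h')⟩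
  rintro ⟨lt, Hp, Fp, ⟨-, -, -, t, b, ht, hb, htX, hbX, htb⟩, hA, hB⟩
  have htop : X ∈ topsets H F := ⟨hX, hF⟩
  have hbot : Xᶜ ∈ bottomsets H F := ⟨hX', by rwa [compl_compl]⟩
  have h₁ : ∀ A' : Set S, A' ⊆ X → none ∈ hullOf Hp (some '' A') → none ∈ t X :=
    fun A' hA' h => h (t X) ⟨(ht.mapsTo htop).1, by rwa [Set.image_subset_iff, htX X htop]⟩
  have h₂ : ∀ A' : Set S, X ∩ A' = ∅ → none ∈ hullOf Hp (some '' A') → none ∉ t X := by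
    intro A' hA' h
    have := h (b Xᶜ) ⟨(hb.mapsTo hbot).1, by
      rw [Set.image_subset_iff, hbX _ hbot]
      exact (Set.disjoint_iff_inter_eq_empty.mpr hA').symm.subset_compl_right⟩
    rwa [htb X htop hbot] at this
  rcases hsep with ⟨h, h'⟩ | ⟨h, h'⟩
  · exact h₂ B h' hB (h₁ A h hA)
  · exact h₂ A h hA (h₁ B h' hB)

end Extension

theorem theorem3p10 {S : Type*} [LinearOrder S] [Finite S] (H : Set (Set S))
    (hH : IsPseudohalfplane (· < ·) H) (A B : Set S) (hAB : Disjoint A B) :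
    -- The equivalence for the pseudohalfplane hypergraph `H`.
    List.TFAE [
      ∃ H' F' : Set (Set S), H ⊆ H' ∧ IsWitness (· < ·) H' F' ∧ ¬ HasVertexInHulls H' F' A B,
      ∃ H' F' : Set (Set S), H ⊆ H' ∧ IsWitness (· < ·) H' F' ∧
        ¬ ∃ D : Set S, D.ncard ≤ 4 ∧ HasVertexInHulls H' F' (A ∩ D) (B ∩ D),
      ∃ X : Set S, IsPseudohalfplane (· < ·) (insert X H) ∧ Separates X A B] ∧
    -- The same for `H` given with `F`, all extensions keeping the topsets and bottomsets of `H`.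
    ∀ F : Set (Set S), IsWitness (· < ·) H F →
      List.TFAE [
        ∃ H' F' : Set (Set S), H ⊆ H' ∧ IsWitness (· < ·) H' F' ∧
          topsets H F ⊆ topsets H' F' ∧ bottomsets H F ⊆ bottomsets H' F' ∧
          ¬ HasVertexInHulls H' F' A B,
        ∃ H' F' : Set (Set S), H ⊆ H' ∧ IsWitness (· < ·) H' F' ∧
          topsets H F ⊆ topsets H' F' ∧ bottomsets H F ⊆ bottomsets H' F' ∧
          ¬ ∃ D : Set S, D.ncard ≤ 4 ∧ HasVertexInHulls H' F' (A ∩ D) (B ∩ D),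
        ∃ (X : Set S) (F' : Set (Set S)), IsWitness (· < ·) (insert X H) F' ∧
          topsets H F ⊆ topsets (insert X H) F' ∧
          bottomsets H F ⊆ bottomsets (insert X H) F' ∧ Separates X A B] := by
  have small : ∀ {H' F' : Set (Set S)}, ¬ HasVertexInHulls H' F' A B →
      ¬ ∃ D : Set S, D.ncard ≤ 4 ∧ HasVertexInHulls H' F' (A ∩ D) (B ∩ D) :=
    fun h ⟨D, _, hD⟩ => h (hD.mono Set.inter_subset_left Set.inter_subset_left)
  have witness : ∀ {H' F' G : Set (Set S)} {X : Set S}, H ⊆ H' → IsWitness (· < ·) H' F' →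
      F' ⊆ G → ABAFree (· < ·) G → X ∈ G → IsWitness (· < ·) (insert X H) G := by
    rintro H' F' G X hH' hF' hG hG' hX
    refine ⟨hG', Set.insert_subset (.inl hX) fun Y hY => ?_⟩
    exact (hF'.subset (hH' hY)).imp (fun h => hG h) fun h => hG h
  have double : ∀ {F' : Set (Set S)} {X : Set S}, IsWitness (· < ·) (insert X H) F' →
      Separates X A B → IsWitness (· < ·) (insert Xᶜ (insert X H)) F' ∧
        ¬ HasVertexInHulls (insert Xᶜ (insert X H)) F' A B := by
    intro F' X hF' hX
    have hXF := hF'.subset (Set.mem_insert X H)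
    refine ⟨⟨hF'.abaFree, Set.insert_subset ?_ hF'.subset⟩,
      not_hasVertexInHulls_of_separates (by simp) (by simp) hXF hX⟩
    rcases hXF with h | h
    · exact .inr (by simpa using h)
    · exact .inl h
  have hsub : ∀ X : Set S, H ⊆ insert Xᶜ (insert X H) := fun X =>
    (Set.subset_insert _ _).trans (Set.subset_insert _ _)
  constructor
  · tfae_have 1 → 2 := fun ⟨H', F', h, hF', hv⟩ => ⟨H', F', h, hF', small hv⟩
    tfae_have 2 → 3 := fun ⟨H', F', h, hF', hv⟩ => by
      obtain ⟨G, X, hFG, hG, hX, hsep⟩ := exists_separator hF' hAB hv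
      exact ⟨X, ⟨G, witness h hF' hFG hG hX⟩, hsep⟩
    tfae_have 3 → 1 := fun ⟨X, ⟨F', hF'⟩, hsep⟩ =>
      ⟨_, F', hsub X, (double hF' hsep).1, (double hF' hsep).2⟩
    tfae_finish
  · intro F hF
    tfae_have 1 → 2 := fun ⟨H', F', h, hF', ht, hb, hv⟩ => ⟨H', F', h, hF', ht, hb, small hv⟩
    tfae_have 2 → 3 := fun ⟨H', F', h, hF', ht, hb, hv⟩ => by
      obtain ⟨G, X, hFG, hG, hX, hsep⟩ := exists_separator hF' hAB hv
      exact ⟨X, G, witness h hF' hFG hG hX,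
        fun Y hY => ⟨.inr hY.1, hFG (ht hY).2⟩, fun Y hY => ⟨.inr hY.1, hFG (hb hY).2⟩, hsep⟩
    tfae_have 3 → 1 := fun ⟨X, F', hF', ht, hb, hsep⟩ =>
      ⟨_, F', hsub X, (double hF' hsep).1, fun Y hY => ⟨hsub X hY.1, (ht hY).2⟩,
        fun Y hY => ⟨hsub X hY.1, (hb hY).2⟩, (double hF' hsep).2⟩
    tfae_finish
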